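/- Let $X$ be a completely regular Hausdorff topological space with topology $\mathscr O$, and let $\mathscr B$ be a $\sigma$-algebra on $X$ with $\mathscr O\subseteq\mathscr B$. A \emph{filter in $\mathscr B$} is a non-empty family $\mathscr F\subseteq\mathscr B$ such that for all $F,G\in\mathscr F$ there is a non-empty $H\in\mathscr F$ with $H\subseteq F\cap G$, and such that $B\in\mathscr F$ whenever $B\in\mathscr B$ and $F\subseteq B$ for some $F\in\mathscr F$. An \emph{ultrafilter in $\mathscr B$} is a filter in $\mathscr B$ that is maximal with respect to inclusion; it is \emph{free} if $\bigcap\mathscr F=\emptyset$, and it has the \emph{countable intersection property} if $\bigcap_{n=1}^\infty F_n\neq\emptyset$ for all $F_1,F_2,\ldots\in\mathscr F$. Suppose that every $B\in\mathscr B$ has compact boundary in $X$. If there is no free ultrafilter in $\mathscr B$ with the countable intersection property, then $X$ is realcompact, i.e., homeomorphic to a closed subspace of a product $\mathbb R^I$ for some set $I$. -/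

import Mathlib

universe u

/-- A filter-base in the σ-algebra of `X`: a non-empty family of measurable sets such that any
two members have a non-empty member of the family inside their intersection. -/
def IsMeasFilterBase {X : Type u} [MeasurableSpace X] (A : Set (Set X)) : Prop :=
  A.Nonempty ∧ (∀ B ∈ A, MeasurableSet B) ∧
    ∀ B ∈ A, ∀ C ∈ A, ∃ D ∈ A, D.Nonempty ∧ D ⊆ B ∩ C

/-- A filter in the σ-algebra of `X`: a filter-base that contains every measurable superset of
each of its members. -/
def IsMeasFilter {X : Type u} [MeasurableSpace X] (F : Set (Set X)) : Prop :=
  IsMeasFilterBase F ∧ ∀ A ∈ F, ∀ B : Set X, MeasurableSet B → A ⊆ B → B ∈ F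

/-- An ultrafilter in the σ-algebra of `X`: a filter that is maximal for inclusion. -/
def IsMeasUltrafilter {X : Type u} [MeasurableSpace X] (F : Set (Set X)) : Prop :=
  Maximal IsMeasFilter F

/-- A family of sets is free if its intersection is empty. -/
def IsFreeFamily {X : Type u} (F : Set (Set X)) : Prop :=
  ⋂₀ F = ∅

/-- The countable intersection property: countably many members always have a common point. -/
def HasCIP {X : Type u} (F : Set (Set X)) : Prop :=
  ∀ f : ℕ → Set X, (∀ n, f n ∈ F) → (⋂ n, f n).Nonempty

/-- A space is realcompact if it is homeomorphic to a closed subspace of a product of copies of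
the real line. -/
def IsRealcompact (X : Type u) [TopologicalSpace X] : Prop :=
  ∃ (ι : Type u) (S : Set (ι → ℝ)), IsClosed S ∧ Nonempty (X ≃ₜ S)

/-!
The evaluations `x ↦ (f x)_f` embed `X` into `ℝ^C(X, ℝ)`, so it suffices that the image is closed.
Suppose `p` is in its closure but not in the image, and let `L` be the filter on `X` traced by the
neighbourhoods of `p`; it contains the complement of every point. Every continuous real function `G`
on the product takes the value `G p` on the image: otherwise the restriction of `G - G p` to `X` has
a continuous reciprocal `k`, and `k * (G - G p) = 1` on the image yields `p k * 0 = 1` in the limit.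
For `G` a weighted sum of separating functions this says that countably many members of `L` have a
common point. If `B` has compact boundary, the image of the boundary is closed and misses `p`, so
`B` and its complement cannot both accumulate at `p`, and `L` contains one of them. The measurable
members of `L` thus form a free ultrafilter with the countable intersection property.
-/

open Filter Topology Set

section ZeroSets

variable {Y ι : Type*} [TopologicalSpace Y]

theorem exists_continuousMap_eq_zero_iff_forall [Countable ι] (f : ι → C(Y, ℝ)) :
    ∃ g : C(Y, ℝ), ∀ y, g y = 0 ↔ ∀ i, f i y = 0 := by
  have := Encodable.ofCountable ι
  let term (i : ι) (y : Y) : ℝ := (1 / 2) ^ Encodable.encode i * min |f i y| 1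
  have term_nonneg (y : Y) (i : ι) : 0 ≤ term i y := by positivity
  have term_eq_zero_iff (i : ι) (y : Y) : term i y = 0 ↔ f i y = 0 := by
    simpa [term, min_eq_iff] using fun h : f i y = 0 => by simp [h]
  have norm_term_le (i : ι) (y : Y) : ‖term i y‖ ≤ (1 / 2) ^ Encodable.encode i := by
    rw [Real.norm_of_nonneg (term_nonneg y i)]
    exact mul_le_of_le_one_right (by positivity) (min_le_right _ _)
  have continuous_tsum_term : Continuous fun y => ∑' i, term i y :=
    continuous_tsum (by fun_prop) summable_geometric_two_encode norm_term_le
  refine ⟨⟨_, continuous_tsum_term⟩, fun y => ?_⟩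
  have summable_term : Summable fun i => term i y :=
    .of_norm_bounded summable_geometric_two_encode fun i => norm_term_le i y
  calc ∑' i, term i y = 0 ↔ HasSum (fun i => term i y) 0 := summable_term.hasSum_iff.symm
    _ ↔ (fun i => term i y) = 0 := hasSum_zero_iff_of_nonneg (term_nonneg y)
    _ ↔ ∀ i, f i y = 0 := by simp only [funext_iff, Pi.zero_apply, term_eq_zero_iff]

variable [CompletelyRegularSpace Y] {y : Y}

theorem exists_continuousMap_zero_eqOn_one {K : Set Y} (hK : IsClosed K) (hy : y ∉ K) :
    ∃ f : C(Y, ℝ), f y = 0 ∧ EqOn f 1 K := by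
  obtain ⟨f, hf, hfy, hfK⟩ := CompletelyRegularSpace.completely_regular y K hK hy
  exact ⟨⟨fun z => f z, by fun_prop⟩, congrArg Subtype.val hfy,
    fun z hz => congrArg Subtype.val (hfK hz)⟩

theorem exists_continuousMap_zeroSet_subset_iInter [Countable ι] {V : ι → Set Y}
    (hV : ∀ i, V i ∈ 𝓝 y) : ∃ g : C(Y, ℝ), g y = 0 ∧ g ⁻¹' {0} ⊆ ⋂ i, V i := by
  have separate (i : ι) : ∃ f : C(Y, ℝ), f y = 0 ∧ EqOn f 1 (interior (V i))ᶜ :=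
    exists_continuousMap_zero_eqOn_one isOpen_interior.isClosed_compl
      (not_not.2 (mem_interior_iff_mem_nhds.2 (hV i)))
  choose f hfy hfV using separate
  obtain ⟨g, hg⟩ := exists_continuousMap_eq_zero_iff_forall f
  refine ⟨g, (hg y).2 hfy, fun z hz => mem_iInter.2 fun i => interior_subset ?_⟩
  by_contra hzV
  exact zero_ne_one (((hg z).1 hz i).symm.trans (hfV i hzV))

end ZeroSets

section TraceFilter

variable {X Y : Type*} [TopologicalSpace Y] {φ : X → Y} {p : Y}

theorem mem_comap_nhds_iff_notMem_closure_image_compl {s : Set X} :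
    s ∈ comap φ (𝓝 p) ↔ p ∉ closure (φ '' sᶜ) := by
  rw [mem_comap_iff_compl, ← mem_interior_iff_mem_nhds, interior_compl, mem_compl_iff]

theorem comap_nhds_le_cofinite_of_notMem_range [T1Space Y] (hp : p ∉ range φ) :
    comap φ (𝓝 p) ≤ cofinite := by
  refine le_cofinite_iff_compl_singleton_mem.2 fun x => ?_
  rw [mem_comap_nhds_iff_notMem_closure_image_compl, compl_compl, image_singleton,
    closure_singleton]
  exact fun hpx => hp ⟨x, hpx.symm⟩

end TraceFilter

/-- The evaluation map `x ↦ (f x)_f` of `X` into the product of copies of the line indexed by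
`C(X, ℝ)`, bundled with its continuity. The closure of its range is the Hewitt realcompactification
of a completely regular Hausdorff space `X`. -/
def realEval (X : Type*) [TopologicalSpace X] : C(X, C(X, ℝ) → ℝ) :=
  ContinuousMap.pi id

section RealEval

variable {X : Type*} [TopologicalSpace X] {p : C(X, ℝ) → ℝ} {S : Set X}

theorem apply_eq_of_mem_closure_image_realEval (hp : p ∈ closure (realEval X '' S)) {f : C(X, ℝ)}
    {G : (C(X, ℝ) → ℝ) → ℝ} (hG : Continuous G) (hfG : EqOn f (G ∘ realEval X) S) : p f = G p :=
  have eqOn_image : EqOn (fun q : C(X, ℝ) → ℝ => q f) G (realEval X '' S) :=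
    forall_mem_image.2 fun _ hx => hfG hx
  eqOn_image.closure (continuous_apply f) hG hp

theorem isInducing_realEval [CompletelyRegularSpace X] : IsInducing (realEval X) := by
  refine isInducing_iff_nhds.2 fun x => le_antisymm
    ((realEval X).continuous.tendsto x).le_comap fun U hU => ?_
  obtain ⟨f, hfx, hfU⟩ := exists_continuousMap_zero_eqOn_one isOpen_interior.isClosed_compl
    (not_not.2 (mem_interior_iff_mem_nhds.2 hU))
  refine mem_comap_nhds_iff_notMem_closure_image_compl.2 fun hx => ?_
  have f_eq_one : f x = 1 := apply_eq_of_mem_closure_image_realEval hx continuous_const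
    fun z hz => hfU fun hzU => hz (interior_subset hzU)
  exact zero_ne_one (hfx.symm.trans f_eq_one)

theorem exists_apply_realEval_eq_of_mem_closure_range (hp : p ∈ closure (range (realEval X)))
    (G : C(C(X, ℝ) → ℝ, ℝ)) : ∃ x, G (realEval X x) = G p := by
  by_contra! hne
  let k : C(X, ℝ) := ⟨fun x => (G (realEval X x) - G p)⁻¹,
    ((G.comp (realEval X)).continuous.sub continuous_const).inv₀ fun x => sub_ne_zero.2 (hne x)⟩
  have k_mul : EqOn (fun q : C(X, ℝ) → ℝ => q k * (G q - G p)) 1 (range (realEval X)) :=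
    forall_mem_range.2 fun x => inv_mul_cancel₀ (sub_ne_zero.2 (hne x))
  have k_mul_at : p k * (G p - G p) = 1 :=
    k_mul.closure (by fun_prop) continuous_const hp
  rw [sub_self, mul_zero] at k_mul_at
  exact zero_ne_one k_mul_at

theorem nonempty_iInter_of_mem_comap_realEval {ι : Type*} [Countable ι]
    (hp : p ∈ closure (range (realEval X))) {B : ι → Set X}
    (hB : ∀ i, B i ∈ comap (realEval X) (𝓝 p)) : (⋂ i, B i).Nonempty := by
  choose V hV hVB using hB
  obtain ⟨G, hGp, hGV⟩ := exists_continuousMap_zeroSet_subset_iInter hV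
  obtain ⟨x, hx⟩ := exists_apply_realEval_eq_of_mem_closure_range hp G
  have hxV : realEval X x ∈ ⋂ i, V i := hGV (hx.trans hGp)
  exact ⟨x, mem_iInter.2 fun i => hVB i (mem_iInter.1 hxV i)⟩

theorem closure_image_realEval_inter_compl_subset (B : Set X) :
    closure (realEval X '' B) ∩ closure (realEval X '' Bᶜ) ⊆
      closure (realEval X '' frontier B) := by
  rintro p ⟨hpB, hpBc⟩
  by_contra hp
  obtain ⟨g, hgp, hgB⟩ := exists_continuousMap_zero_eqOn_one isClosed_closure hp
  let cut : C(X, ℝ) := ⟨B.indicator fun x => 1 - g (realEval X x), continuous_indicator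
    (fun x hx => sub_eq_zero.2 (hgB (subset_closure (mem_image_of_mem _ hx))).symm)
    (by fun_prop)⟩
  have cut_eq_on : p cut = 1 - g p :=
    apply_eq_of_mem_closure_image_realEval hpB (G := fun q => 1 - g q) (by fun_prop)
      eqOn_indicator
  have cut_eq_off : p cut = 0 :=
    apply_eq_of_mem_closure_image_realEval hpBc continuous_const eqOn_indicator'
  linarith

theorem mem_or_compl_mem_comap_realEval (hp : p ∉ range (realEval X)) {B : Set X}
    (hB : IsCompact (frontier B)) :
    B ∈ comap (realEval X) (𝓝 p) ∨ Bᶜ ∈ comap (realEval X) (𝓝 p) := by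
  simp only [mem_comap_nhds_iff_notMem_closure_image_compl, compl_compl]
  rw [← not_and_or]
  rintro ⟨hpBc, hpB⟩
  have hp_frontier := closure_image_realEval_inter_compl_subset B ⟨hpB, hpBc⟩
  rw [(hB.image (realEval X).continuous).isClosed.closure_eq] at hp_frontier
  exact hp (image_subset_range _ _ hp_frontier)

end RealEval

theorem isRealcompact_of_isClosed_range_realEval {X : Type u} [TopologicalSpace X] [T35Space X]
    (hX : IsClosed (range (realEval X))) : IsRealcompact X :=
  ⟨C(X, ℝ), range (realEval X), hX, ⟨isInducing_realEval.isEmbedding.toHomeomorph⟩⟩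

section MeasurableMembers

variable {X : Type u} [MeasurableSpace X] {L : Filter X}

theorem isMeasFilter_setOf_measurableSet_mem [NeBot L] :
    IsMeasFilter {B | MeasurableSet B ∧ B ∈ L} := by
  refine ⟨⟨⟨univ, .univ, univ_mem⟩, fun B hB => hB.1, fun B hB C hC => ?_⟩,
    fun A hA B hB hAB => ⟨hB, mem_of_superset hA.2 hAB⟩⟩
  have hBC : B ∩ C ∈ L := inter_mem hB.2 hC.2
  exact ⟨B ∩ C, ⟨hB.1.inter hC.1, hBC⟩, nonempty_of_mem hBC, Subset.rfl⟩

theorem isMeasUltrafilter_setOf_measurableSet_mem [NeBot L]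
    (hL : ∀ B, MeasurableSet B → B ∈ L ∨ Bᶜ ∈ L) :
    IsMeasUltrafilter {B | MeasurableSet B ∧ B ∈ L} := by
  refine ⟨isMeasFilter_setOf_measurableSet_mem, fun F hF hLF B hB => ?_⟩
  have hB_meas : MeasurableSet B := hF.1.2.1 B hB
  refine ⟨hB_meas, (hL B hB_meas).resolve_right fun hBc => ?_⟩
  obtain ⟨D, -, ⟨x, hx⟩, hD⟩ := hF.1.2.2 B hB Bᶜ (hLF ⟨hB_meas.compl, hBc⟩)
  exact (hD hx).2 (hD hx).1

theorem isFreeFamily_setOf_measurableSet_mem [MeasurableSingletonClass X] (hL : L ≤ cofinite) :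
    IsFreeFamily {B | MeasurableSet B ∧ B ∈ L} :=
  eq_empty_iff_forall_notMem.2 fun x hx =>
    hx {x}ᶜ ⟨(measurableSet_singleton x).compl, le_cofinite_iff_compl_singleton_mem.1 hL x⟩ rfl

end MeasurableMembers

theorem mainTheorem5_general {X : Type u} [TopologicalSpace X] [T35Space X]
    [MeasurableSpace X] [MeasurableSingletonClass X]
    (hbd : ∀ B : Set X, MeasurableSet B → IsCompact (frontier B))
    (hfree : ¬ ∃ F : Set (Set X), IsMeasUltrafilter F ∧ IsFreeFamily F ∧ HasCIP F) :
    IsRealcompact X := by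
  refine isRealcompact_of_isClosed_range_realEval (isClosed_of_closure_subset fun p hp => ?_)
  by_contra hp_range
  have : NeBot (comap (realEval X) (𝓝 p)) :=
    comap_neBot_iff_frequently.2 (mem_closure_iff_frequently.1 hp)
  exact hfree ⟨{B | MeasurableSet B ∧ B ∈ comap (realEval X) (𝓝 p)},
    isMeasUltrafilter_setOf_measurableSet_mem fun B hB =>
      mem_or_compl_mem_comap_realEval hp_range (hbd B hB),
    isFreeFamily_setOf_measurableSet_mem (comap_nhds_le_cofinite_of_notMem_range hp_range),
    fun B hB => nonempty_iInter_of_mem_comap_realEval hp fun n => (hB n).2⟩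

theorem mainTheorem5 {X : Type u} [TopologicalSpace X] [T35Space X]
    [MeasurableSpace X] [OpensMeasurableSpace X]
    (hbd : ∀ B : Set X, MeasurableSet B → IsCompact (frontier B))
    (hfree : ¬ ∃ F : Set (Set X), IsMeasUltrafilter F ∧ IsFreeFamily F ∧ HasCIP F) :
    IsRealcompact X :=
  mainTheorem5_general hbd hfree
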